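/- For permutations $q \in S_k$ and $p = p_1 \cdots p_n \in S_n$ (in one-line notation), an occurrence of the pattern $q$ in $p$ is a sequence of indices $i_1 < \cdots < i_k$ such that $p_{i_1}, \ldots, p_{i_k}$ are in the same relative order as $q_1, \ldots, q_k$. Let $\mathrm{Av}_n(123)$ be the set of all $p \in S_n$ with no occurrence of $123$, let $f_q$ denote the total number of occurrences of $q$ in all the permutations in $\mathrm{Av}_n(123)$, and let $c_n = \frac{1}{n+1}\binom{2n}{n}$ be the $n$th Catalan number. Put $a_n = f_{132}$, $b_n = f_{231}$ and $d_n = f_{321}$. Then, for every $n \ge 0$, $a_n = f_{213}$, $b_n = f_{312}$ and $$2a_n + 2b_n + d_n = \binom{n}{3} c_n,$$ and, for every $n \ge 1$, $$4a_n + 2b_n = (n-2)\left(4^{n-1} - \binom{2n-1}{n}\right).$$ -/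

import Mathlib

namespace PermPattern

/-- The index sequence `f` (strictly increasing) is an occurrence of the pattern `q` in the
permutation `p`: the entries of `p` at these indices are in the same relative order as those of
`q`. Permutations are read in one-line notation, with positions and values shifted to start
at `0`. -/
def IsOccurrence {k n : ℕ} (q : Equiv.Perm (Fin k)) (p : Equiv.Perm (Fin n))
    (f : Fin k → Fin n) : Prop :=
  (∀ i j, i < j → f i < f j) ∧ ∀ i j, q i < q j ↔ p (f i) < p (f j)

instance {k n : ℕ} (q : Equiv.Perm (Fin k)) (p : Equiv.Perm (Fin n)) :
    DecidablePred (IsOccurrence q p) := fun f => by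
  unfold IsOccurrence
  infer_instance

/-- `p` contains the pattern `q`. -/
def Contains {k n : ℕ} (q : Equiv.Perm (Fin k)) (p : Equiv.Perm (Fin n)) : Prop :=
  ∃ f, IsOccurrence q p f

instance {k n : ℕ} (q : Equiv.Perm (Fin k)) :
    DecidablePred fun p : Equiv.Perm (Fin n) => Contains q p := fun p => by
  unfold Contains
  infer_instance

/-- The set `Av_n(q)` of permutations of length `n` that avoid `q`. -/
def Av (n : ℕ) {k : ℕ} (q : Equiv.Perm (Fin k)) : Finset (Equiv.Perm (Fin n)) :=
  Finset.univ.filter fun p => ¬ Contains q p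

/-- The number of occurrences of the pattern `q` in the permutation `p`. -/
def num {k n : ℕ} (q : Equiv.Perm (Fin k)) (p : Equiv.Perm (Fin n)) : ℕ :=
  (Finset.univ.filter fun f : Fin k → Fin n => IsOccurrence q p f).card

/-- The total number of occurrences of the pattern `q` in the permutations in `C`. -/
def totalNum {k n : ℕ} (q : Equiv.Perm (Fin k)) (C : Finset (Equiv.Perm (Fin n))) : ℕ :=
  ∑ p ∈ C, num q p

/-- The pattern 123. -/
def p123 : Equiv.Perm (Fin 3) := ⟨![0, 1, 2], ![0, 1, 2], by decide, by decide⟩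

/-- The pattern 132. -/
def p132 : Equiv.Perm (Fin 3) := ⟨![0, 2, 1], ![0, 2, 1], by decide, by decide⟩

/-- The pattern 213. -/
def p213 : Equiv.Perm (Fin 3) := ⟨![1, 0, 2], ![1, 0, 2], by decide, by decide⟩

/-- The pattern 231. -/
def p231 : Equiv.Perm (Fin 3) := ⟨![1, 2, 0], ![2, 0, 1], by decide, by decide⟩

/-- The pattern 312. -/
def p312 : Equiv.Perm (Fin 3) := ⟨![2, 0, 1], ![1, 2, 0], by decide, by decide⟩

/-- The pattern 321. -/
def p321 : Equiv.Perm (Fin 3) := ⟨![2, 1, 0], ![2, 1, 0], by decide, by decide⟩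

end PermPattern

namespace PermPattern

open Finset

/-! Three indices in a 123-avoider form one of the five other patterns, so those counts add up to
`n.choose 3`. Reverse complement fixes 123 and exchanges 132 with 213 and 231 with 312; with the
Catalan count of the avoiders this gives the first identity. For the second, pair every noninversion
with a third position. Patterns 132 and 213 contain two noninversions, 231 and 312 one, 321 none, so
`4a + 2b` is `n - 2` times the total number of noninversions over the avoiders
(`weighted_sum_num_of_avoids`). That total comes from the generating tree: inserting a new maximum
at position `j` keeps 123 avoided exactly when the first `j` entries decrease, and creates `j`
noninversions. Labelling a permutation by the length `k` of its initial decreasing run, the children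
are labelled `k + 1` (for `j = 0`) and `j` for `1 ≤ j ≤ k`. Closed forms for `descendants` and
`pathWeight`, taken at the root label `0`, give `catalan n` and `4 ^ r - (2 * r + 1).choose (r +
1)`. -/

/-! ### Numbers of descendants and accumulated noninversions in the generating tree -/

/-- The number of descendants after `r` generations of a node labelled `k` in the generating tree
in which a node labelled `k` has children labelled `1, …, k + 1`. -/
def descendants (k : ℕ) : ℕ → ℤ
  | 0 => 1
  | r + 1 => ∑ j ∈ range (k + 1), descendants (j + 1) r

/-- The total weight of the paths of length `r` from a node labelled `k`, where passing to the child
labelled `k + 1` has weight `0` and passing to a child labelled `j ≤ k` has weight `j`. -/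
def pathWeight (k : ℕ) : ℕ → ℤ
  | 0 => 0
  | r + 1 => ∑ j ∈ range (k + 1), pathWeight (j + 1) r +
      ∑ j ∈ range k, ((j : ℤ) + 1) * descendants (j + 1) r

theorem descendants_zero_succ (r : ℕ) : descendants 0 (r + 1) = descendants 1 r := by
  simp [descendants]

/-- The children of `k + 1` are those of `k` and one more, labelled `k + 2`. Closed forms can thus
be checked by induction on `r`, then on `k`. -/
theorem descendants_succ_succ (k r : ℕ) :
    descendants (k + 1) (r + 1) = descendants k (r + 1) + descendants (k + 2) r := by
  simp only [descendants]
  rw [sum_range_succ]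

theorem pathWeight_zero_succ (r : ℕ) : pathWeight 0 (r + 1) = pathWeight 1 r := by
  simp [pathWeight]

theorem pathWeight_succ_succ (k r : ℕ) :
    pathWeight (k + 1) (r + 1) =
      pathWeight k (r + 1) + pathWeight (k + 2) r + (k + 1) * descendants (k + 1) r := by
  simp only [pathWeight]
  rw [sum_range_succ (fun j => pathWeight (j + 1) r) (k + 1),
    sum_range_succ (fun j : ℕ => ((j : ℤ) + 1) * descendants (j + 1) r) k]
  ring

theorem descendants_eq (k r : ℕ) :
    descendants k (r + 1) = (2 * r + 2 + k).choose (r + 1) - (2 * r + 2 + k).choose r := by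
  induction r generalizing k with
  | zero => simp [descendants]; ring
  | succ r ih =>
    induction k with
    | zero =>
      rw [descendants_zero_succ, ih]
      have h₁ := Nat.choose_succ_succ' (2 * r + 3) (r + 1)
      have h₂ := Nat.choose_succ_succ' (2 * r + 3) r
      have h₃ : (2 * r + 3).choose (r + 1) = (2 * r + 3).choose (r + 2) :=
        Nat.choose_symm_of_eq_add (by ring)
      push_cast [← @Nat.cast_inj ℤ] at h₁ h₂ h₃
      ring_nf at *
      linarith
    | succ k ihk =>
      rw [descendants_succ_succ, ihk, ih]
      have h₁ := Nat.choose_succ_succ' (2 * r + k + 4) (r + 1)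
      have h₂ := Nat.choose_succ_succ' (2 * r + k + 4) r
      push_cast [← @Nat.cast_inj ℤ] at h₁ h₂
      ring_nf at *
      linarith

theorem sum_range_choose_succ (N m : ℕ) :
    ∑ i ∈ range (m + 1), (N + 1).choose i =
      ∑ i ∈ range (m + 1), N.choose i + ∑ i ∈ range m, N.choose i := by
  rw [sum_range_succ', sum_range_succ' _ m]
  simp only [Nat.choose_succ_succ', sum_add_distrib, Nat.choose_zero_right]
  ring

/-- The formula satisfies the recurrence of `pathWeight_succ_succ` by Pascal's rule for binomials
and for partial row sums. At `k = 0` the partial sum is nearly half a row, hence the power of 4 in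
`pathWeight_zero_left`. -/
theorem two_mul_pathWeight_eq (k r : ℕ) :
    2 * pathWeight k (r + 1) = (k + 1) * (∑ i ∈ range (r + 1), (2 * r + 2 + k).choose i : ℕ) +
      ((k : ℤ) ^ 2 - 1) * (2 * r + k + 1).choose r := by
  induction r generalizing k with
  | zero =>
    induction k with
    | zero => simp [pathWeight]
    | succ k ih =>
      rw [pathWeight_succ_succ]
      simp [pathWeight, descendants] at ih ⊢
      linarith
  | succ r ih =>
    induction k with
    | zero =>
      rw [pathWeight_zero_succ, ih]
      have h := sum_range_choose_succ (2 * r + 3) (r + 1)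
      have h' := sum_range_succ (fun i => (2 * r + 3).choose i) (r + 1)
      have e : 2 * (r + 1) + 2 + 0 = 2 * r + 3 + 1 := by ring
      have e' : 2 * (r + 1) + 0 + 1 = 2 * r + 3 := by ring
      rw [e, e', h, h']
      push_cast
      ring
    | succ k ihk =>
      rw [pathWeight_succ_succ, descendants_eq, mul_add, mul_add, ihk, ih]
      have h₁ := sum_range_choose_succ (2 * r + k + 4) (r + 1)
      have h₂ := Nat.choose_succ_succ' (2 * r + k + 3) r
      have h₃ := sum_range_succ (fun i => (2 * r + k + 4).choose i) (r + 1)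
      have e₁ : 2 * (r + 1) + 2 + k = 2 * r + k + 4 := by ring
      have e₂ : 2 * (r + 1) + k + 1 = 2 * r + k + 3 := by ring
      have e₃ : 2 * r + 2 + (k + 2) = 2 * r + k + 4 := by ring
      have e₄ : 2 * r + (k + 2) + 1 = 2 * r + k + 3 := by ring
      have e₅ : 2 * (r + 1) + 2 + (k + 1) = 2 * r + k + 4 + 1 := by ring
      have e₆ : 2 * (r + 1) + (k + 1) + 1 = 2 * r + k + 3 + 1 := by ring
      have e₇ : 2 * r + 2 + (k + 1) = 2 * r + k + 3 := by ring
      rw [e₁, e₂, e₃, e₄, e₅, e₆, e₇, h₁, h₃, h₂]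
      push_cast [h₂]
      ring

theorem descendants_zero_left (n : ℕ) : descendants 0 n = catalan n := by
  cases n with
  | zero => simp [descendants]
  | succ r =>
    rw [descendants_eq]
    have h₁ := succ_mul_catalan_eq_centralBinom (r + 1)
    have h₂ := Nat.choose_succ_right_eq (2 * r + 2) r
    rw [Nat.centralBinom, show 2 * (r + 1) = 2 * r + 2 by ring] at h₁
    rw [show 2 * r + 2 - r = r + 2 by omega] at h₂
    push_cast [← @Nat.cast_inj ℤ] at h₁ h₂
    have : ((r : ℤ) + 2) ≠ 0 := by positivity
    apply mul_left_cancel₀ this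
    simp only [add_zero]
    linarith

theorem pathWeight_zero_left (r : ℕ) :
    pathWeight 0 (r + 1) = 4 ^ r - (2 * r + 1).choose (r + 1) := by
  have h := two_mul_pathWeight_eq 0 r
  have h₁ := sum_range_choose_succ (2 * r + 1) r
  have h₂ := sum_range_succ (fun i => (2 * r + 1).choose i) r
  have h₃ := Nat.sum_range_choose_halfway r
  have h₄ : (2 * r + 1).choose (r + 1) = (2 * r + 1).choose r :=
    Nat.choose_symm_of_eq_add (by ring)
  rw [add_zero, h₁] at h
  rw [h₃] at h h₂
  push_cast [← @Nat.cast_inj ℤ] at h h₂ h₄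
  rw [h₄]
  simp only [add_zero] at h
  linarith

/-! ### Occurrences of patterns of length three -/

theorem isOccurrence_three_iff {n : ℕ} (q : Equiv.Perm (Fin 3)) (p : Equiv.Perm (Fin n))
    (f : Fin 3 → Fin n) : IsOccurrence q p f ↔ (f 0 < f 1 ∧ f 1 < f 2) ∧
      (q 0 < q 1 ↔ p (f 0) < p (f 1)) ∧ (q 0 < q 2 ↔ p (f 0) < p (f 2)) ∧
      (q 1 < q 2 ↔ p (f 1) < p (f 2)) := by
  constructor
  · rintro ⟨h, h'⟩
    exact ⟨⟨h _ _ (by decide), h _ _ (by decide)⟩, h' _ _, h' _ _, h' _ _⟩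
  · rintro ⟨⟨h₀, h₁⟩, h₂, h₃, h₄⟩
    have key : ∀ i j : Fin 3, i < j → f i < f j ∧ (q i < q j ↔ p (f i) < p (f j)) := by
      intro i j hij
      have h := h₀.trans h₁
      fin_cases i <;> fin_cases j <;> first | exact absurd hij (by decide) | exact ⟨‹_›, ‹_›⟩
    refine ⟨fun i j hij => (key i j hij).1, fun i j => ?_⟩
    rcases lt_trichotomy i j with hij | rfl | hij
    · exact (key i j hij).2
    · simp
    · have hf := (key j i hij).1
      have hq : q i ≠ q j := q.injective.ne hij.ne'
      have hp : p (f i) ≠ p (f j) := p.injective.ne hf.ne'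
      -- By injectivity, the comparison for a descending index pair is the negation of that for the
      -- ascending pair.
      rw [← not_iff_not, not_lt, not_lt, hq.symm.le_iff_lt, hp.symm.le_iff_lt]
      exact (key j i hij).2

/-- Sum over the increasing triples of positions. -/
def tripleSum (n : ℕ) (w : Fin n → Fin n → Fin n → ℕ) : ℕ :=
  ∑ i, ∑ j, ∑ l, if i < j ∧ j < l then w i j l else 0

theorem num_eq_tripleSum {n : ℕ} (q : Equiv.Perm (Fin 3)) (p : Equiv.Perm (Fin n)) :
    num q p = tripleSum n fun i j l => if (q 0 < q 1 ↔ p i < p j) ∧ (q 0 < q 2 ↔ p i < p l) ∧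
      (q 1 < q 2 ↔ p j < p l) then 1 else 0 := by
  rw [num, card_filter, tripleSum]
  simp only [← ite_and]
  let e : (Fin n × Fin n) × Fin n ≃ (Fin 3 → Fin n) :=
    { toFun := fun x => ![x.1.1, x.1.2, x.2]
      invFun := fun f => ((f 0, f 1), f 2)
      left_inv := fun x => rfl
      right_inv := fun f => by ext i; fin_cases i <;> rfl }
  rw [← e.sum_comp, Fintype.sum_prod_type, Fintype.sum_prod_type]
  refine sum_congr rfl fun i _ => sum_congr rfl fun j _ => sum_congr rfl fun l _ => ?_
  simp only [isOccurrence_three_iff]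
  rfl

theorem tripleSum_congr {n : ℕ} {v w : Fin n → Fin n → Fin n → ℕ}
    (h : ∀ i j l, i < j → j < l → v i j l = w i j l) : tripleSum n v = tripleSum n w := by
  unfold tripleSum
  refine sum_congr rfl fun i _ => sum_congr rfl fun j _ => sum_congr rfl fun l _ => ?_
  split_ifs with hc
  · exact h i j l hc.1 hc.2
  · rfl

theorem tripleSum_add {n : ℕ} (v w : Fin n → Fin n → Fin n → ℕ) :
    tripleSum n (fun i j l => v i j l + w i j l) = tripleSum n v + tripleSum n w := by
  unfold tripleSum
  simp only [← sum_add_distrib, ← ite_add_zero]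

theorem tripleSum_mul {n : ℕ} (c : ℕ) (w : Fin n → Fin n → Fin n → ℕ) :
    tripleSum n (fun i j l => c * w i j l) = c * tripleSum n w := by
  unfold tripleSum
  simp only [mul_sum, mul_ite, mul_zero]

theorem sum_range_choose_two (n : ℕ) : ∑ l ∈ range n, l.choose 2 = n.choose 3 := by
  induction n with
  | zero => rfl
  | succ n ih => rw [sum_range_succ, ih, Nat.choose_succ_succ' n 2, add_comm]

theorem tripleSum_one (n : ℕ) : tripleSum n (fun _ _ _ => 1) = n.choose 3 := by
  have h₁ : ∀ j l : Fin n, (∑ i : Fin n, if i < j ∧ j < l then 1 else 0) =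
      if (j : ℕ) < l then (j : ℕ) else 0 := by
    intro j l
    by_cases h : j < l
    · simp only [h, and_true, ← card_filter, Fin.lt_def.1 h, if_true]
      rw [filter_gt_eq_Iio, Fin.card_Iio]
    · have h' : ¬ (j : ℕ) < l := h
      simp [h, h']
  have h₂ : ∀ l : Fin n, (∑ j : Fin n, if (j : ℕ) < l then (j : ℕ) else 0) =
      (l : ℕ).choose 2 := by
    intro l
    rw [Fin.sum_univ_eq_sum_range (fun j => if j < (l : ℕ) then j else 0), ← sum_filter,
      show (range n).filter (· < (l : ℕ)) = range l by ext; simp; omega, sum_range_id,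
      Nat.choose_two_right]
  unfold tripleSum
  -- With the largest index outermost, the inner sums are `j` and then `l.choose 2`.
  calc _ = ∑ l : Fin n, ∑ j : Fin n, ∑ i : Fin n, (if i < j ∧ j < l then 1 else 0) := by
        rw [sum_comm]
        exact (sum_congr rfl fun j _ => sum_comm).trans sum_comm
    _ = n.choose 3 := by
        simp_rw [h₁, h₂]
        rw [Fin.sum_univ_eq_sum_range (fun l => l.choose 2), sum_range_choose_two]

/-- The number of noninversions of `p`. -/
def noninv {n : ℕ} (p : Equiv.Perm (Fin n)) : ℕ :=
  ∑ i, ∑ j, if i < j ∧ p i < p j then 1 else 0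

/-- Double counting of a noninversion together with any position `l`: either `l` is one of its two
ends, or it lies left of, between or right of them and completes a triple. Keeping `2 * noninv p` on
the right avoids truncated subtraction. -/
theorem mul_noninv {n : ℕ} (p : Equiv.Perm (Fin n)) :
    n * noninv p = 2 * noninv p + tripleSum n fun i j l =>
      (if p i < p j then 1 else 0) + (if p i < p l then 1 else 0) +
        (if p j < p l then 1 else 0) := by
  have h₁ : n * noninv p = ∑ i, ∑ j, ∑ l : Fin n, if i < j ∧ p i < p j then 1 else 0 := by
    simp only [noninv, mul_sum, sum_const, card_univ, Fintype.card_fin, smul_eq_mul]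
  have h₂ : ∀ i j l : Fin n, (if i < j ∧ p i < p j then 1 else 0) =
      (if l = i then (if i < j ∧ p i < p j then 1 else 0) else 0) +
      (if l = j then (if i < j ∧ p i < p j then 1 else 0) else 0) +
      ((if l < i ∧ i < j then (if p i < p j then 1 else 0) else 0) +
       (if i < l ∧ l < j then (if p i < p j then 1 else 0) else 0) +
       (if i < j ∧ j < l then (if p i < p j then 1 else 0) else 0)) := by
    intro i j l
    by_cases hp : p i < p j
    · simp only [hp, and_true, if_true]
      split_ifs <;> omega
    · simp [hp]
  rw [h₁, sum_congr rfl fun i _ => sum_congr rfl fun j _ => sum_congr rfl fun l _ => h₂ i j l]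
  simp only [sum_add_distrib, tripleSum_add]
  have e₁ : (∑ i : Fin n, ∑ j : Fin n, ∑ l : Fin n,
      if l = i then (if i < j ∧ p i < p j then 1 else 0) else 0) = noninv p := by
    simp only [sum_ite_eq', mem_univ, if_true, noninv]
  have e₂ : (∑ i : Fin n, ∑ j : Fin n, ∑ l : Fin n,
      if l = j then (if i < j ∧ p i < p j then 1 else 0) else 0) = noninv p := by
    simp only [sum_ite_eq', mem_univ, if_true, noninv]
  have e₃ : (∑ i : Fin n, ∑ j : Fin n, ∑ l : Fin n,
      if l < i ∧ i < j then (if p i < p j then 1 else 0) else 0) =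
      tripleSum n fun _ j l => if p j < p l then 1 else 0 :=
    (sum_congr rfl fun i _ => sum_comm).trans sum_comm
  have e₄ : (∑ i : Fin n, ∑ j : Fin n, ∑ l : Fin n,
      if i < l ∧ l < j then (if p i < p j then 1 else 0) else 0) =
      tripleSum n fun i _ l => if p i < p l then 1 else 0 :=
    sum_congr rfl fun i _ => sum_comm
  rw [e₁, e₂, e₃, e₄]
  simp only [tripleSum]
  ring

theorem contains_p123_iff {n : ℕ} (p : Equiv.Perm (Fin n)) :
    Contains p123 p ↔ ∃ i j l, (i < j ∧ j < l) ∧ p i < p j ∧ p j < p l := by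
  have h₀ : p123 0 < p123 1 := by decide
  have h₁ : p123 0 < p123 2 := by decide
  have h₂ : p123 1 < p123 2 := by decide
  simp only [Contains, isOccurrence_three_iff, h₀, h₁, h₂, true_iff]
  constructor
  · rintro ⟨f, hf, h, -, h'⟩
    exact ⟨_, _, _, hf, h, h'⟩
  · rintro ⟨i, j, l, hf, h, h'⟩
    exact ⟨![i, j, l], hf, h, h.trans h', h'⟩

theorem sum_num_of_avoids {n : ℕ} {p : Equiv.Perm (Fin n)} (hp : ¬ Contains p123 p) :
    num p132 p + num p213 p + num p231 p + num p312 p + num p321 p = n.choose 3 := by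
  rw [contains_p123_iff] at hp
  push Not at hp
  rw [← tripleSum_one]
  simp only [num_eq_tripleSum, ← tripleSum_add]
  refine tripleSum_congr fun i j l hij hjl => ?_
  have h := hp i j l ⟨hij, hjl⟩
  have h₁ : p i ≠ p j := p.injective.ne hij.ne
  have h₂ : p j ≠ p l := p.injective.ne hjl.ne
  have h₃ : p i ≠ p l := p.injective.ne (hij.trans hjl).ne
  simp [p132, p213, p231, p312, p321]
  split_ifs <;> omega

theorem weighted_sum_num_of_avoids {n : ℕ} {p : Equiv.Perm (Fin n)} (hp : ¬ Contains p123 p) :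
    2 * noninv p + (2 * num p132 p + 2 * num p213 p + num p231 p + num p312 p) =
      n * noninv p := by
  rw [contains_p123_iff] at hp
  push Not at hp
  rw [mul_noninv]
  simp only [num_eq_tripleSum, ← tripleSum_add, ← tripleSum_mul]
  congr 1
  refine tripleSum_congr fun i j l hij hjl => ?_
  have h := hp i j l ⟨hij, hjl⟩
  have h₁ : p i ≠ p j := p.injective.ne hij.ne
  have h₂ : p j ≠ p l := p.injective.ne hjl.ne
  have h₃ : p i ≠ p l := p.injective.ne (hij.trans hjl).ne
  simp [p132, p213, p231, p312]
  split_ifs <;> omega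

/-! ### Reverse complement -/

/-- The reverse complement of a permutation. -/
def revCompl {n : ℕ} (p : Equiv.Perm (Fin n)) : Equiv.Perm (Fin n) :=
  Fin.revPerm.trans (p.trans Fin.revPerm)

theorem revCompl_apply {n : ℕ} (p : Equiv.Perm (Fin n)) (i : Fin n) :
    revCompl p i = (p i.rev).rev := rfl

theorem revCompl_revCompl {n : ℕ} (p : Equiv.Perm (Fin n)) : revCompl (revCompl p) = p := by
  ext i
  simp [revCompl_apply]

theorem IsOccurrence.revCompl {k n : ℕ} {q : Equiv.Perm (Fin k)} {p : Equiv.Perm (Fin n)}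
    {f : Fin k → Fin n} (h : IsOccurrence q p f) :
    IsOccurrence (revCompl q) (revCompl p) fun i => (f i.rev).rev := by
  refine ⟨fun i j hij => Fin.rev_lt_rev.2 (h.1 _ _ (Fin.rev_lt_rev.2 hij)), fun i j => ?_⟩
  simp only [revCompl_apply, Fin.rev_rev, Fin.rev_lt_rev]
  exact h.2 _ _

theorem isOccurrence_revCompl_iff {k n : ℕ} {q : Equiv.Perm (Fin k)} {p : Equiv.Perm (Fin n)}
    {f : Fin k → Fin n} :
    IsOccurrence (revCompl q) (revCompl p) (fun i => (f i.rev).rev) ↔ IsOccurrence q p f := by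
  refine ⟨fun h => ?_, IsOccurrence.revCompl⟩
  simpa only [revCompl_revCompl, Fin.rev_rev] using h.revCompl

/-- Conjugation of index sequences by the reversals. -/
def revSeq (k n : ℕ) : Equiv.Perm (Fin k → Fin n) :=
  Function.Involutive.toPerm (fun f i => (f i.rev).rev) fun f => by simp

theorem num_revCompl {k n : ℕ} (q : Equiv.Perm (Fin k)) (p : Equiv.Perm (Fin n)) :
    num (revCompl q) (revCompl p) = num q p := by
  refine (card_equiv (revSeq k n) fun f => ?_).symm
  simp only [mem_filter, mem_univ, true_and]
  exact isOccurrence_revCompl_iff.symm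

theorem contains_revCompl {k n : ℕ} (q : Equiv.Perm (Fin k)) (p : Equiv.Perm (Fin n)) :
    Contains (revCompl q) (revCompl p) ↔ Contains q p := by
  unfold Contains
  rw [← (revSeq k n).exists_congr_right]
  exact exists_congr fun f => isOccurrence_revCompl_iff

/-- Reversing positions and values together preserves relative order, so occurrences and avoiders
correspond bijectively. -/
theorem totalNum_revCompl {k l n : ℕ} (q : Equiv.Perm (Fin k)) (s : Equiv.Perm (Fin l)) :
    totalNum (revCompl q) (Av n (revCompl s)) = totalNum q (Av n s) := by
  refine (sum_equiv (Function.Involutive.toPerm revCompl revCompl_revCompl)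
    (fun p => ?_) fun p _ => ?_).symm
  · simp only [Av, mem_filter, mem_univ, true_and]
    exact not_congr (contains_revCompl s p).symm
  · exact (num_revCompl q p).symm

theorem revCompl_p123 : revCompl p123 = p123 := by decide

theorem revCompl_p132 : revCompl p132 = p213 := by decide

theorem revCompl_p231 : revCompl p231 = p312 := by decide

/-! ### Insertion of a new maximum -/

/-- The permutation obtained from `p` by inserting a new maximal entry at position `j`. -/
def insertMax {n : ℕ} (j : Fin (n + 1)) (p : Equiv.Perm (Fin n)) : Equiv.Perm (Fin (n + 1)) :=
  (finSuccEquiv' j).trans (p.optionCongr.trans finSuccEquivLast.symm)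

@[simp]
theorem insertMax_self {n : ℕ} (j : Fin (n + 1)) (p : Equiv.Perm (Fin n)) :
    insertMax j p j = Fin.last n := by
  simp [insertMax]

@[simp]
theorem insertMax_succAbove {n : ℕ} (j : Fin (n + 1)) (p : Equiv.Perm (Fin n)) (i : Fin n) :
    insertMax j p (j.succAbove i) = (p i).castSucc := by
  simp [insertMax]

theorem insertMax_bijective (n : ℕ) :
    Function.Bijective fun x : Fin (n + 1) × Equiv.Perm (Fin n) => insertMax x.1 x.2 := by
  rw [Fintype.bijective_iff_injective_and_card]
  constructor
  · rintro ⟨j, p⟩ ⟨j', p'⟩ h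
    have h : insertMax j p = insertMax j' p' := h
    obtain rfl : j = j' := by
      apply (insertMax j p).injective
      rw [insertMax_self, h, insertMax_self]
    have : p = p' := by
      ext i
      have := congrArg Fin.val (Equiv.congr_fun h (j.succAbove i))
      simpa using this
    rw [this]
  -- Surjectivity is by counting: `(n + 1) * n! = (n + 1)!`.
  · simp [Fintype.card_perm, Nat.factorial_succ]

/-- The first `m` entries of `p` are decreasing. -/
def DecreasingUpTo {n : ℕ} (p : Equiv.Perm (Fin n)) (m : ℕ) : Prop :=
  ∀ i i' : Fin n, i < i' → (i' : ℕ) < m → p i' < p i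

instance {n : ℕ} (p : Equiv.Perm (Fin n)) : DecidablePred (DecreasingUpTo p) := fun m => by
  unfold DecreasingUpTo
  infer_instance

/-- The length of the initial decreasing run of `p`. -/
def initialRun {n : ℕ} (p : Equiv.Perm (Fin n)) : ℕ :=
  Nat.findGreatest (DecreasingUpTo p) n

theorem DecreasingUpTo.mono {n : ℕ} {p : Equiv.Perm (Fin n)} {m m' : ℕ}
    (h : DecreasingUpTo p m) (hm : m' ≤ m) : DecreasingUpTo p m' :=
  fun i i' hi hi' => h i i' hi (hi'.trans_le hm)

theorem decreasingUpTo_zero {n : ℕ} (p : Equiv.Perm (Fin n)) : DecreasingUpTo p 0 :=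
  fun _ _ _ h => absurd h (Nat.not_lt_zero _)

/-- The bound `hm` matters: for `m > n` the predicate only tests all of `p`, whereas `initialRun p ≤
n`. -/
theorem decreasingUpTo_iff_le_initialRun {n : ℕ} (p : Equiv.Perm (Fin n)) {m : ℕ} (hm : m ≤ n) :
    DecreasingUpTo p m ↔ m ≤ initialRun p :=
  ⟨Nat.le_findGreatest hm,
    (Nat.findGreatest_spec (P := DecreasingUpTo p) (Nat.zero_le n)
      (decreasingUpTo_zero p)).mono⟩

theorem initialRun_le {n : ℕ} (p : Equiv.Perm (Fin n)) : initialRun p ≤ n :=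
  Nat.findGreatest_le n

/-- The new maximum can only play the role of 3, which requires a noninversion among the entries
before it. -/
theorem contains_insertMax_iff {n : ℕ} (j : Fin (n + 1)) (p : Equiv.Perm (Fin n)) :
    Contains p123 (insertMax j p) ↔ Contains p123 p ∨ ¬ DecreasingUpTo p j := by
  simp only [contains_p123_iff, DecreasingUpTo]
  constructor
  · rintro ⟨a, b, c, ⟨hab, hbc⟩, h, h'⟩
    have ha : a ≠ j := by
      rintro rfl
      rw [insertMax_self] at h
      exact (Fin.le_last _).not_gt h
    have hb : b ≠ j := by
      rintro rfl
      rw [insertMax_self] at h'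
      exact (Fin.le_last _).not_gt h'
    obtain ⟨a, rfl⟩ := Fin.exists_succAbove_eq ha
    obtain ⟨b, rfl⟩ := Fin.exists_succAbove_eq hb
    rw [insertMax_succAbove, insertMax_succAbove, Fin.castSucc_lt_castSucc_iff] at h
    rw [Fin.succAbove_lt_succAbove_iff] at hab
    by_cases hc : c = j
    · subst hc
      rw [Fin.succAbove_lt_iff_castSucc_lt] at hbc
      exact Or.inr fun H => (H a b hab hbc).not_gt h
    · obtain ⟨c, rfl⟩ := Fin.exists_succAbove_eq hc
      rw [insertMax_succAbove, insertMax_succAbove, Fin.castSucc_lt_castSucc_iff] at h'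
      rw [Fin.succAbove_lt_succAbove_iff] at hbc
      exact Or.inl ⟨a, b, c, ⟨hab, hbc⟩, h, h'⟩
  · rintro (⟨a, b, c, ⟨hab, hbc⟩, h, h'⟩ | h)
    · exact ⟨j.succAbove a, j.succAbove b, j.succAbove c, by simpa using ⟨hab, hbc⟩,
        by simpa using ⟨h, h'⟩⟩
    · push Not at h
      obtain ⟨a, b, hab, hb, h⟩ := h
      refine ⟨j.succAbove a, j.succAbove b, j, ⟨by simpa using hab, ?_⟩, ?_, ?_⟩
      · rw [Fin.succAbove_lt_iff_castSucc_lt]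
        exact hb
      · simpa using h.lt_of_ne (p.injective.ne hab.ne)
      · simp

theorem noninv_insertMax {n : ℕ} (j : Fin (n + 1)) (p : Equiv.Perm (Fin n)) :
    noninv (insertMax j p) = noninv p + j := by
  have hlast : ∀ x : Fin (n + 1), ¬ Fin.last n < x := fun x => (Fin.le_last x).not_gt
  have hcount : (∑ i : Fin n, if i.castSucc < j then 1 else 0) = (j : ℕ) := by
    simp only [Fin.lt_def, Fin.val_castSucc]
    rw [Fin.sum_univ_eq_sum_range (fun i => if i < (j : ℕ) then 1 else 0), ← card_filter,
      show (range n).filter (· < (j : ℕ)) = range j by ext; simp; omega, card_range]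
  simp only [noninv, Fin.sum_univ_succAbove _ j, insertMax_self, insertMax_succAbove, hlast,
    and_false, if_false, sum_const_zero, zero_add, Fin.succAbove_lt_iff_castSucc_lt,
    Fin.castSucc_lt_last, and_true, sum_add_distrib, hcount, Fin.succAbove_lt_succAbove_iff,
    Fin.castSucc_lt_castSucc_iff]
  ring

theorem decreasingUpTo_insertMax_zero {n : ℕ} (p : Equiv.Perm (Fin n)) (m : ℕ) :
    DecreasingUpTo (insertMax 0 p) (m + 1) ↔ DecreasingUpTo p m := by
  have h : ∀ i : Fin n, insertMax 0 p i.succ = (p i).castSucc := insertMax_succAbove 0 p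
  constructor
  · intro H i i' hi hi'
    have := H i.succ i'.succ (Fin.succ_lt_succ_iff.2 hi) (by simpa using hi')
    simpa [h] using this
  · intro H i i' hi hi'
    obtain ⟨i', rfl⟩ := Fin.exists_succ_eq.2 (Fin.ne_zero_of_lt hi)
    rw [h]
    rcases Fin.eq_zero_or_eq_succ i with rfl | ⟨i, rfl⟩
    · rw [insertMax_self]
      exact Fin.castSucc_lt_last _
    · rw [h, Fin.castSucc_lt_castSucc_iff]
      exact H i i' (Fin.succ_lt_succ_iff.1 hi) (by simpa using hi')

theorem initialRun_insertMax_zero {n : ℕ} (p : Equiv.Perm (Fin n)) :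
    initialRun (insertMax 0 p) = initialRun p + 1 := by
  refine (Nat.findGreatest_eq_iff).2 ⟨Nat.succ_le_succ (initialRun_le p), fun _ => ?_, ?_⟩
  · rw [decreasingUpTo_insertMax_zero, decreasingUpTo_iff_le_initialRun p (initialRun_le p)]
  · intro m hm hmn
    obtain ⟨m, rfl⟩ : ∃ l, m = l + 1 := ⟨m - 1, by omega⟩
    rw [decreasingUpTo_insertMax_zero, decreasingUpTo_iff_le_initialRun p (by omega)]
    omega

theorem initialRun_insertMax_of_ne_zero {n : ℕ} {j : Fin (n + 1)} (hj : j ≠ 0)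
    {p : Equiv.Perm (Fin n)} (hp : DecreasingUpTo p j) : initialRun (insertMax j p) = j := by
  have hj' : 0 < (j : ℕ) := Fin.pos_iff_ne_zero.2 hj
  refine (Nat.findGreatest_eq_iff).2 ⟨j.is_lt.le, fun _ => ?_, ?_⟩
  · intro i i' hi hi'
    obtain ⟨i, rfl⟩ := Fin.exists_succAbove_eq (hi.trans hi').ne
    obtain ⟨i', rfl⟩ := Fin.exists_succAbove_eq (Fin.lt_def.2 hi').ne
    rw [insertMax_succAbove, insertMax_succAbove, Fin.castSucc_lt_castSucc_iff]
    refine hp i i' (Fin.succAbove_lt_succAbove_iff.1 hi) ?_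
    exact (Fin.succAbove_lt_iff_castSucc_lt _ _).1 hi'
  · intro m hm hmn H
    -- A longer run would force the entry at position 0 to exceed the maximum, which sits at `j >
    -- 0`.
    have := H ⟨0, by omega⟩ j hj' hm
    rw [insertMax_self] at this
    exact (Fin.le_last _).not_gt this

theorem initialRun_insertMax {n : ℕ} {j : Fin (n + 1)} {p : Equiv.Perm (Fin n)}
    (hp : DecreasingUpTo p j) :
    initialRun (insertMax j p) = if (j : ℕ) = 0 then initialRun p + 1 else j := by
  by_cases hj : j = 0
  · subst hj
    simp [initialRun_insertMax_zero]
  · rw [initialRun_insertMax_of_ne_zero hj hp, if_neg (Fin.val_ne_zero_iff.2 hj)]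

/-- Summation over the permutations avoiding `123` along the generating tree. -/
theorem sum_Av_succ (n : ℕ) (F : ℕ → ℕ → ℤ) :
    ∑ p ∈ Av (n + 1) p123, F (initialRun p) (noninv p) =
      ∑ p ∈ Av n p123, ∑ j ∈ range (initialRun p + 1),
        F (if j = 0 then initialRun p + 1 else j) (noninv p + j) := by
  have h₁ : ∀ p ∈ Av n p123, (∑ j ∈ range (initialRun p + 1),
      F (if j = 0 then initialRun p + 1 else j) (noninv p + j)) =
      ∑ j : Fin (n + 1), if DecreasingUpTo p j then
        F (if (j : ℕ) = 0 then initialRun p + 1 else j) (noninv p + j) else 0 := by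
    intro p _
    have hle := initialRun_le p
    simp only [fun j : Fin (n + 1) => decreasingUpTo_iff_le_initialRun p (Nat.le_of_lt_succ j.2)]
    rw [Fin.sum_univ_eq_sum_range (fun j => if j ≤ initialRun p then
        F (if j = 0 then initialRun p + 1 else j) (noninv p + j) else 0), ← sum_filter]
    congr 1
    ext j
    simp
    omega
  rw [sum_congr rfl h₁, Av, Av, sum_filter, sum_filter,
    ← (Equiv.ofBijective _ (insertMax_bijective n)).sum_comp, Fintype.sum_prod_type_right]
  refine sum_congr rfl fun p _ => ?_
  simp only [Equiv.ofBijective_apply, contains_insertMax_iff, noninv_insertMax]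
  by_cases hp : Contains p123 p
  · simp [hp]
  · simp only [hp, not_false_eq_true, if_true, false_or, not_not]
    refine sum_congr rfl fun j _ => ?_
    by_cases hd : DecreasingUpTo p j
    · simp only [hd, if_true, initialRun_insertMax hd]
    · simp only [hd, if_false]

/-! ### Enumeration -/

theorem sum_children (k : ℕ) (h : ℕ → ℤ) :
    ∑ j ∈ range (k + 1), h (if j = 0 then k + 1 else j) = ∑ j ∈ range (k + 1), h (j + 1) := by
  rw [sum_range_succ', sum_range_succ]
  simp

/-- The induction trades one generation of descendants for one level of the tree, so `n` must vary.
-/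
theorem card_Av_add (n r : ℕ) :
    ((Av (n + r) p123).card : ℤ) = ∑ p ∈ Av n p123, descendants (initialRun p) r := by
  induction r generalizing n with
  | zero => simp [descendants]
  | succ r ih =>
    rw [← add_assoc, add_right_comm, ih, sum_Av_succ n fun k _ => descendants k r]
    exact sum_congr rfl fun p _ => sum_children _ fun k => descendants k r

/-- Every descendant inherits the noninversions of `p`; `pathWeight` collects those created by later
insertions. -/
theorem sum_noninv_Av_add (n r : ℕ) :
    ∑ p ∈ Av (n + r) p123, (noninv p : ℤ) =
      ∑ p ∈ Av n p123,
        (descendants (initialRun p) r * noninv p + pathWeight (initialRun p) r) := by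
  induction r generalizing n with
  | zero => simp [descendants, pathWeight]
  | succ r ih =>
    rw [← add_assoc, add_right_comm, ih,
      sum_Av_succ n fun k x => descendants k r * x + pathWeight k r]
    refine sum_congr rfl fun p _ => ?_
    generalize initialRun p = k
    generalize noninv p = x
    have h₁ := sum_children k fun k => descendants k r * x + pathWeight k r
    have h₂ : ∑ j ∈ range (k + 1), descendants (if j = 0 then k + 1 else j) r * (j : ℤ) =
        ∑ j ∈ range k, ((j : ℤ) + 1) * descendants (j + 1) r := by
      rw [sum_range_succ']
      simp [mul_comm]
    calc _ = ∑ j ∈ range (k + 1), (descendants (if j = 0 then k + 1 else j) r * x +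
          pathWeight (if j = 0 then k + 1 else j) r) +
          ∑ j ∈ range (k + 1), descendants (if j = 0 then k + 1 else j) r * (j : ℤ) := by
          rw [← sum_add_distrib]
          refine sum_congr rfl fun j _ => ?_
          push_cast
          ring
      _ = _ := by
          rw [h₁, h₂, sum_add_distrib, ← sum_mul, descendants, pathWeight]
          ring

theorem Av_zero_p123 : Av 0 p123 = {1} := by decide

theorem card_Av_p123 (n : ℕ) : (Av n p123).card = catalan n := by
  have h := card_Av_add 0 n
  rw [zero_add, Av_zero_p123, sum_singleton, Nat.le_zero.1 (initialRun_le _),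
    descendants_zero_left] at h
  exact_mod_cast h

theorem sum_noninv_Av_succ (r : ℕ) :
    ∑ p ∈ Av (r + 1) p123, (noninv p : ℤ) = 4 ^ r - (2 * r + 1).choose (r + 1) := by
  have h := sum_noninv_Av_add 0 (r + 1)
  rw [zero_add, Av_zero_p123, sum_singleton, Nat.le_zero.1 (initialRun_le _),
    pathWeight_zero_left] at h
  simpa [noninv] using h

end PermPattern

theorem mainTheorem11 (n a b d : ℕ)
    (ha : a = PermPattern.totalNum PermPattern.p132 (PermPattern.Av n PermPattern.p123))
    (hb : b = PermPattern.totalNum PermPattern.p231 (PermPattern.Av n PermPattern.p123))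
    (hd : d = PermPattern.totalNum PermPattern.p321 (PermPattern.Av n PermPattern.p123)) :
    a = PermPattern.totalNum PermPattern.p213 (PermPattern.Av n PermPattern.p123) ∧
    b = PermPattern.totalNum PermPattern.p312 (PermPattern.Av n PermPattern.p123) ∧
    2 * a + 2 * b + d = n.choose 3 * catalan n ∧
    (1 ≤ n →
      4 * (a : ℤ) + 2 * (b : ℤ) =
        ((n : ℤ) - 2) * (4 ^ (n - 1) - ((2 * n - 1).choose n : ℤ))) := by
  have h₁ := PermPattern.totalNum_revCompl (n := n) PermPattern.p132 PermPattern.p123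
  have h₂ := PermPattern.totalNum_revCompl (n := n) PermPattern.p231 PermPattern.p123
  rw [PermPattern.revCompl_p123, PermPattern.revCompl_p132, ← ha] at h₁
  rw [PermPattern.revCompl_p123, PermPattern.revCompl_p231, ← hb] at h₂
  have hav : ∀ p ∈ PermPattern.Av n PermPattern.p123,
      ¬ PermPattern.Contains PermPattern.p123 p := fun p hp => (Finset.mem_filter.1 hp).2
  have h₃ := Finset.sum_congr rfl fun p hp => PermPattern.sum_num_of_avoids (hav p hp)
  have h₄ := Finset.sum_congr rfl fun p hp => PermPattern.weighted_sum_num_of_avoids (hav p hp)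
  simp only [Finset.sum_add_distrib, ← Finset.mul_sum, Finset.sum_const, smul_eq_mul,
    PermPattern.card_Av_p123] at h₃ h₄
  unfold PermPattern.totalNum at ha hb hd h₁ h₂
  rw [h₁, h₂, ← ha, ← hb, ← hd] at h₃
  rw [h₁, h₂, ← ha, ← hb] at h₄
  -- `h₃` sums the five-pattern identity over all avoiders; `h₄`, its noninversion-weighted
  -- analogue, gives the last identity.
  refine ⟨h₁.symm, h₂.symm, by linarith, fun hn => ?_⟩
  obtain ⟨r, rfl⟩ : ∃ r, n = r + 1 := ⟨n - 1, by omega⟩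
  have h₅ := PermPattern.sum_noninv_Av_succ r
  rw [Nat.add_sub_cancel, show 2 * (r + 1) - 1 = 2 * r + 1 by omega, ← h₅]
  zify at h₄
  push_cast
  linarith
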